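/- Let $\mathcal{E}$ be a finitely complete and finitely cocomplete symmetric monoidal closed category with tensor unit $U$, unit isomorphisms $\lambda:U\otimes A\to A$, $\rho:A\otimes U\to A$ and symmetry $\tau$. A *(strict) interval* in $\mathcal{E}$ is a cocategory object whose object of coobjects is $U$: objects $I$, $I_2$ and maps $\bot,\top:U\to I$, $i:I\to U$, $\downarrow,\uparrow,\star:I\to I_2$ such that $I_2$ is the pushout of $\bot$ and $\top$ with $\uparrow\circ\bot=\downarrow\circ\top$ (write $[h,k]:I_2\to X$ for the map with $[h,k]\circ{\downarrow}=h$ and $[h,k]\circ{\uparrow}=k$, defined when $h\circ\top=k\circ\bot$); $i\circ\bot=1_U=i\circ\top$; $\star\circ\bot={\downarrow}\circ\bot$ and $\star\circ\top={\uparrow}\circ\top$; $[\bot\circ i,1_I]\circ\star=1_I=[1_I,\top\circ i]\circ\star$; and $\star$ is coassociative, i.e. if $I_3$ is the pushout with coprojections $\Downarrow,\Uparrow:I_2\to I_3$, $\Downarrow\circ\uparrow=\Uparrow\circ\downarrow$, then $[\Downarrow\circ\downarrow,\Uparrow\circ\star]\circ\star=[\Downarrow\circ\star,\Uparrow\circ\uparrow]\circ\star$.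 An interval is a comonoid with counit $i$ and comultiplication $\Delta=[(\bot\otimes I)\circ\lambda^{-1},(I\otimes\top)\circ\rho^{-1}]\circ\star:I\to I\otimes I$. For maps $f,g:A\to B$, a *2-cell* (homotopy) $f\Rightarrow g$ is a map $\eta:A\otimes I\to B$ with $\eta\circ(A\otimes\bot)=f\circ\rho$ and $\eta\circ(A\otimes\top)=g\circ\rho$. With identities $1_f=f\circ\rho\circ(A\otimes i)$ and vertical composition $\gamma\cdot\eta=[\eta,\gamma]\circ(A\otimes\star)$, the maps $A\to B$ and the 2-cells between them form a category $\mathcal{E}(A,B)$. The horizontal composite $\gamma*\eta$ of $\eta:A\otimes I\to B$ and $\gamma:B\otimes I\to C$ is $A\otimes I\xrightarrow{A\otimes\Delta}A\otimes(I\otimes I)\cong(A\otimes I)\otimes I\xrightarrow{\eta\otimes I}B\otimes I\xrightarrow{\gamma}C$. The interval $I$ is *representable* if cotensors with the arrow category $\mathbf 2$ exist for this structure: for every object $A$ there are an object $P$ and isomorphisms of categories $\mathcal{E}(B,P)\cong\mathcal{E}(B,A)^{\mathbf 2}$, 2-natural in $B$ (compatible with precomposition by maps and by 2-cells $u\Rightarrow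 v:B'\to B$). A *unital distributive lattice* structure on a comonoid $(L,\epsilon,\Delta)$ consists of maps $\wedge,\vee:L\otimes L\to L$ and $\bot,\top:U\to L$ such that: - $\wedge$ and $\vee$ are associative and commutative, and $\wedge\circ\Delta=1_L=\vee\circ\Delta$; - (absorption) for $(\diamondsuit,\clubsuit)=(\wedge,\vee)$ and $(\vee,\wedge)$, the composite $L\otimes L\xrightarrow{\Delta\otimes L}(L\otimes L)\otimes L\cong L\otimes(L\otimes L)\xrightarrow{L\otimes\clubsuit}L\otimes L\xrightarrow{\diamondsuit}L$ equals $\rho\circ(L\otimes\epsilon)$; - (units) $\top$ is a two-sided unit for $\wedge$ and $\bot$ is a two-sided unit for $\vee$; moreover $\diamondsuit\circ(t\otimes L)=t\circ\epsilon\circ\lambda$ and $\diamondsuit\circ(L\otimes t)=t\circ\epsilon\circ\rho$ for $(\diamondsuit,t)=(\wedge,\bot)$ and $(\vee,\top)$; - (distributivity) for $(\diamondsuit,\clubsuit)=(\wedge,\vee)$ and $(\vee,\wedge)$, the map $\diamondsuit\circ(L\otimes\clubsuit):L\otimes(L\otimes L)\to L$ equals the composite $$L\otimes(L\otimes L)\xrightarrow{\Delta\otimes(L\otimes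 L)}(L\otimes L)\otimes(L\otimes L)\cong(L\otimes(L\otimes L))\otimes L\xrightarrow{\tau\otimes L}((L\otimes L)\otimes L)\otimes L\cong(L\otimes L)\otimes(L\otimes L)\xrightarrow{\diamondsuit\otimes\diamondsuit}L\otimes L\xrightarrow{\clubsuit}L,$$ where $\tau:L\otimes(L\otimes L)\to(L\otimes L)\otimes L$ and the isomorphisms are associativity isomorphisms. **Proposition.** Let $I$ be a representable interval in $\mathcal{E}$. Then there are maps $\wedge,\vee:I\otimes I\to I$ which, together with $\bot,\top:U\to I$, make the comonoid $(I,i,\Delta)$ a unital distributive lattice; in particular $\bot$ is the unit for $\vee$ and $\top$ is the unit for $\wedge$. This structure is unique: no other pair of maps does so. Moreover, $\wedge$ is the unique map $m:I\otimes I\to I$ such that both $m$ and $m\circ\tau$ are 2-cells $\bot\circ i\Rightarrow 1_I$, and $\vee$ is the unique map $m:I\otimes I\to I$ such that both $m$ and $m\circ\tau$ are 2-cells $1_I\Rightarrow\top\circ i$. -/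

import Mathlib

open CategoryTheory MonoidalCategory Limits
open scoped ComonObj

universe v u

namespace RepInterval

/-! ### Cocategory objects and strict intervals

Composition is written in diagrammatic order: `f ≫ g` is `g ∘ f`. -/

/-- The data of a cocategory object with object of coobjects `C₀`, together with the axioms
that do not involve maps induced out of pushouts. -/
structure CocategoryData {E : Type u} [Category.{v} E] (C₀ : E) where
  /-- The object of coarrows. -/
  C₁ : E
  /-- The object of cocomposable coarrows. -/
  C₂ : E
  /-- The dual of the domain map. -/
  bot : C₀ ⟶ C₁
  /-- The dual of the codomain map. -/
  top : C₀ ⟶ C₁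
  /-- The coidentity map. -/
  i : C₁ ⟶ C₀
  /-- The initial segment. -/
  down : C₁ ⟶ C₂
  /-- The final segment. -/
  up : C₁ ⟶ C₂
  /-- Cocomposition. -/
  star : C₁ ⟶ C₂
  isPushout : IsPushout bot top up down
  bot_i : bot ≫ i = 𝟙 C₀
  top_i : top ≫ i = 𝟙 C₀
  bot_star : bot ≫ star = bot ≫ down
  top_star : top ≫ star = top ≫ up

/-- The map `[h, k] : C₂ ⟶ X` which is `h` on the initial and `k` on the final segment. -/
noncomputable def CocategoryData.copair {E : Type u} [Category.{v} E] {C₀ : E}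
    (I : CocategoryData C₀) {X : E} (h k : I.C₁ ⟶ X) (w : I.top ≫ h = I.bot ≫ k) : I.C₂ ⟶ X :=
  I.isPushout.desc k h w.symm

@[simp]
theorem CocategoryData.down_copair {E : Type u} [Category.{v} E] {C₀ : E}
    (I : CocategoryData C₀) {X : E} (h k : I.C₁ ⟶ X) (w : I.top ≫ h = I.bot ≫ k) :
    I.down ≫ I.copair h k w = h :=
  I.isPushout.inr_desc k h w.symm

@[simp]
theorem CocategoryData.up_copair {E : Type u} [Category.{v} E] {C₀ : E}
    (I : CocategoryData C₀) {X : E} (h k : I.C₁ ⟶ X) (w : I.top ≫ h = I.bot ≫ k) :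
    I.up ≫ I.copair h k w = k :=
  I.isPushout.inl_desc k h w.symm

/-- A cocategory object with object of coobjects `C₀`. In the coassociative law the object of
cocomposable triples is the pushout of `up` and `down`, with coprojections `pushout.inl` (the
first two coarrows) and `pushout.inr` (the last two coarrows). -/
structure Cocategory {E : Type u} [Category.{v} E] [HasPushouts E] (C₀ : E) extends
    CocategoryData C₀ where
  counit_bot : star ≫ toCocategoryData.copair (i ≫ bot) (𝟙 C₁)
    (by rw [reassoc_of% top_i, Category.comp_id]) = 𝟙 C₁
  counit_top : star ≫ toCocategoryData.copair (𝟙 C₁) (i ≫ top)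
    (by rw [reassoc_of% bot_i, Category.comp_id]) = 𝟙 C₁
  coassoc :
    star ≫ toCocategoryData.copair (down ≫ pushout.inl up down) (star ≫ pushout.inr up down)
      (by rw [reassoc_of% bot_star, ← reassoc_of% isPushout.w, pushout.condition]) =
    star ≫ toCocategoryData.copair (star ≫ pushout.inl up down) (up ≫ pushout.inr up down)
      (by rw [reassoc_of% top_star, reassoc_of% isPushout.w, pushout.condition])

/-- A strict interval: a cocategory object whose object of coobjects is the tensor unit. -/
abbrev Interval (E : Type u) [Category.{v} E] [MonoidalCategory E] [HasPushouts E] :=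
  Cocategory (𝟙_ E)

namespace Interval

section Comonoid

variable {E : Type u} [Category.{v} E] [MonoidalCategory E] [HasPushouts E] (I : Interval E)

theorem glue_corner : I.top ≫ (λ_ I.C₁).inv ≫ I.bot ▷ I.C₁ =
    I.bot ≫ (ρ_ I.C₁).inv ≫ I.C₁ ◁ I.top := by
  rw [leftUnitor_inv_naturality_assoc, rightUnitor_inv_naturality_assoc,
    unitors_inv_equal, whisker_exchange]

/-- The comultiplication `I ⟶ I ⊗ I` of an interval:
`[(⊥ ⊗ I) ∘ λ⁻¹, (I ⊗ ⊤) ∘ ρ⁻¹] ∘ ⋆`. -/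
noncomputable def diag : I.C₁ ⟶ I.C₁ ⊗ I.C₁ :=
  I.star ≫ I.copair ((λ_ I.C₁).inv ≫ I.bot ▷ I.C₁) ((ρ_ I.C₁).inv ≫ I.C₁ ◁ I.top)
    I.glue_corner

theorem copair_comp {X Y : E} (h k : I.C₁ ⟶ X) (w : I.top ≫ h = I.bot ≫ k) (t : X ⟶ Y) :
    I.copair h k w ≫ t = I.copair (h ≫ t) (k ≫ t) (by rw [reassoc_of% w]) := by
  apply I.isPushout.hom_ext
  · rw [I.up_copair, reassoc_of% I.up_copair h k w]
  · rw [I.down_copair, reassoc_of% I.down_copair h k w]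

/-- Coassociativity for maps out of `I` (three composable coarrows `h`, `k`, `l` in `X`). -/
theorem star_copair_assoc {X : E} (h k l : I.C₁ ⟶ X) (w : I.top ≫ h = I.bot ≫ k)
    (w' : I.top ≫ k = I.bot ≫ l) :
    I.star ≫ I.copair h (I.star ≫ I.copair k l w')
      (by rw [reassoc_of% I.bot_star, I.down_copair, w]) =
    I.star ≫ I.copair (I.star ≫ I.copair h k w) l
      (by rw [reassoc_of% I.top_star, I.up_copair, w']) := by
  have := I.coassoc =≫ pushout.desc (I.copair h k w) (I.copair k l w') (by simp)
  simpa only [Category.assoc, copair_comp, pushout.inl_desc, pushout.inr_desc, I.down_copair,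
    I.up_copair] using this

theorem bot_diag : I.bot ≫ I.diag = (λ_ (𝟙_ E)).inv ≫ (I.bot ⊗ₘ I.bot) := by
  rw [diag, reassoc_of% I.bot_star, I.down_copair, leftUnitor_inv_naturality_assoc,
    MonoidalCategory.tensorHom_def']

theorem top_diag : I.top ≫ I.diag = (λ_ (𝟙_ E)).inv ≫ (I.top ⊗ₘ I.top) := by
  rw [diag, reassoc_of% I.top_star, I.up_copair, rightUnitor_inv_naturality_assoc,
    MonoidalCategory.tensorHom_def,
    unitors_inv_equal]

/-- The comonoid structure of an interval, with counit the coidentity map `i`. -/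
noncomputable instance comonObj : ComonObj I.C₁ where
  counit := I.i
  comul := I.diag
  counit_comul := by
    have := I.counit_top =≫ (λ_ I.C₁).inv
    rw [diag, Category.assoc, copair_comp]
    rw [Category.assoc, copair_comp] at this
    simpa [whisker_exchange, ← comp_whiskerRight, I.bot_i, ← unitors_inv_equal] using this
  comul_counit := by
    have := I.counit_bot =≫ (ρ_ I.C₁).inv
    rw [diag, Category.assoc, copair_comp]
    rw [Category.assoc, copair_comp] at this
    simpa [← whisker_exchange, ← whiskerLeft_comp, I.top_i, unitors_inv_equal] using this
  comul_assoc := by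
    let T := (λ_ (I.C₁ ⊗ I.C₁)).inv ≫ I.bot ▷ (I.C₁ ⊗ I.C₁)
    let T' := (ρ_ (I.C₁ ⊗ I.C₁)).inv ≫ (I.C₁ ⊗ I.C₁) ◁ I.top ≫ (α_ I.C₁ I.C₁ I.C₁).hom
    let a := (λ_ I.C₁).inv ≫ I.bot ▷ I.C₁
    let b := (ρ_ I.C₁).inv ≫ I.C₁ ◁ I.top
    have hab : I.top ≫ a = I.bot ≫ b := I.glue_corner
    have hk : b ≫ T = a ≫ T' := by
      simp only [a, b, T, T', Category.assoc]
      rw [leftUnitor_inv_naturality_assoc, whisker_exchange]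
      monoidal
    have key := I.star_copair_assoc (a ≫ T) (b ≫ T) (b ≫ T') (by rw [reassoc_of% hab])
      (by rw [hk, reassoc_of% hab])
    have h1 : I.star ≫ I.copair (a ≫ T) (b ≫ T) (by rw [reassoc_of% hab]) =
        (λ_ I.C₁).inv ≫ I.bot ▷ I.C₁ ≫ I.C₁ ◁ I.diag := by
      rw [← whisker_exchange, ← leftUnitor_inv_naturality_assoc]
      conv_rhs => rw [diag, Category.assoc, copair_comp]
    have h2 : I.star ≫ I.copair (b ≫ T) (b ≫ T') (by rw [hk, reassoc_of% hab]) =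
        (ρ_ I.C₁).inv ≫ I.C₁ ◁ I.top ≫ I.diag ▷ I.C₁ ≫ (α_ I.C₁ I.C₁ I.C₁).hom := by
      rw [whisker_exchange_assoc, ← rightUnitor_inv_naturality_assoc]
      conv_rhs => rw [diag, Category.assoc, copair_comp]
      simp only [hk]
      rfl
    have h3 : a ≫ T = (λ_ I.C₁).inv ≫ I.bot ▷ I.C₁ ≫ I.diag ▷ I.C₁ ≫
        (α_ I.C₁ I.C₁ I.C₁).hom := by
      rw [← comp_whiskerRight_assoc, bot_diag]
      simp only [a, T]
      rw [MonoidalCategory.tensorHom_def', Category.assoc, leftUnitor_inv_naturality_assoc]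
      monoidal
    have h4 : b ≫ T' = (ρ_ I.C₁).inv ≫ I.C₁ ◁ I.top ≫ I.C₁ ◁ I.diag := by
      rw [← MonoidalCategory.whiskerLeft_comp, top_diag]
      simp only [b, T']
      rw [MonoidalCategory.tensorHom_def, Category.assoc, rightUnitor_inv_naturality_assoc]
      monoidal
    simp only [h1, h2] at key
    simp only [h3, h4] at key
    nth_rewrite 1 [diag]
    nth_rewrite 2 [diag]
    rw [Category.assoc, Category.assoc, copair_comp, copair_comp]
    simpa only [Category.assoc] using key.symm

end Comonoid

section TwoCells

variable {E : Type u} [Category.{v} E] [MonoidalCategory E] [HasPushouts E]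
  (I : Interval E)

/-- `η : A ⊗ I ⟶ B` is a homotopy (a 2-cell) `f ⇒ g`. -/
structure IsHomotopy {A B : E} (η : A ⊗ I.C₁ ⟶ B) (f g : A ⟶ B) : Prop where
  source : A ◁ I.bot ≫ η = (ρ_ A).hom ≫ f
  target : A ◁ I.top ≫ η = (ρ_ A).hom ≫ g

/-- The category `E(A, B)` induced by an interval: its objects are the maps `A ⟶ B`. -/
structure HomCat (I : Interval E) (A B : E) where
  /-- The underlying map. -/
  arrow : A ⟶ B

variable {I}

/-- The type of homotopies `f ⇒ g`. -/
@[ext]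
structure Homotopy {A B : E} (f g : I.HomCat A B) where
  /-- The underlying map of a homotopy. -/
  map : A ⊗ I.C₁ ⟶ B
  isHomotopy : I.IsHomotopy map f.arrow g.arrow

theorem Homotopy.glue {A B : E} {f g h : I.HomCat A B} (η : Homotopy f g) (γ : Homotopy g h) :
    A ◁ I.top ≫ η.map = A ◁ I.bot ≫ γ.map := by
  rw [η.isHomotopy.target, γ.isHomotopy.source]

theorem hcomp_aux {A B C : E} {b : 𝟙_ E ⟶ I.C₁} {d : I.C₁ ⟶ I.C₁ ⊗ I.C₁}
    (hb : b ≫ d = (λ_ (𝟙_ E)).inv ≫ (b ⊗ₘ b)) {η : A ⊗ I.C₁ ⟶ B} {γ : B ⊗ I.C₁ ⟶ C}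
    {f : A ⟶ B} {h : B ⟶ C} (hη : A ◁ b ≫ η = (ρ_ A).hom ≫ f)
    (hγ : B ◁ b ≫ γ = (ρ_ B).hom ≫ h) :
    A ◁ (b ≫ d) ≫ (α_ A I.C₁ I.C₁).inv ≫ η ▷ I.C₁ ≫ γ = (ρ_ A).hom ≫ f ≫ h := by
  have e : A ◁ ((λ_ (𝟙_ E)).inv ≫ (b ⊗ₘ b)) ≫ (α_ A I.C₁ I.C₁).inv =
      (ρ_ _).inv ≫ (A ◁ b) ▷ 𝟙_ E ≫ (A ⊗ I.C₁) ◁ b := by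
    rw [MonoidalCategory.tensorHom_def]
    monoidal
  rw [hb, reassoc_of% e, whisker_exchange_assoc, ← comp_whiskerRight_assoc, hη, hγ]
  simp

variable [MonoidalClosed E]

variable (I) in
theorem tensorPushout (A : E) :
    IsPushout (A ◁ I.bot) (A ◁ I.top) (A ◁ I.up) (A ◁ I.down) :=
  I.isPushout.map (tensorLeft A)

variable (I) in
/-- The map `[η, γ] : A ⊗ C₂ ⟶ B` out of the pushout `A ⊗ C₂`. -/
noncomputable def tensorCopair {A B : E} (η γ : A ⊗ I.C₁ ⟶ B)
    (w : A ◁ I.top ≫ η = A ◁ I.bot ≫ γ) : A ⊗ I.C₂ ⟶ B :=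
  (I.tensorPushout A).desc γ η w.symm

@[simp]
theorem down_tensorCopair {A B : E} (η γ : A ⊗ I.C₁ ⟶ B)
    (w : A ◁ I.top ≫ η = A ◁ I.bot ≫ γ) : A ◁ I.down ≫ I.tensorCopair η γ w = η :=
  (I.tensorPushout A).inr_desc γ η w.symm

@[simp]
theorem up_tensorCopair {A B : E} (η γ : A ⊗ I.C₁ ⟶ B)
    (w : A ◁ I.top ≫ η = A ◁ I.bot ≫ γ) : A ◁ I.up ≫ I.tensorCopair η γ w = γ :=
  (I.tensorPushout A).inl_desc γ η w.symm

/-- The identity 2-cell `1_f = f ∘ ρ ∘ (A ⊗ i)`. -/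
def Homotopy.refl {A B : E} (f : I.HomCat A B) : Homotopy f f where
  map := A ◁ I.i ≫ (ρ_ A).hom ≫ f.arrow
  isHomotopy :=
    ⟨by rw [← whiskerLeft_comp_assoc, I.bot_i]; simp,
      by rw [← whiskerLeft_comp_assoc, I.top_i]; simp⟩

/-- Vertical composition of `η : f ⇒ g` and `γ : g ⇒ h`: the map `[η, γ] ∘ (A ⊗ ⋆)`. -/
noncomputable def Homotopy.vcomp {A B : E} {f g h : I.HomCat A B} (η : Homotopy f g)
    (γ : Homotopy g h) : Homotopy f h where
  map := A ◁ I.star ≫ I.tensorCopair η.map γ.map (η.glue γ)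
  isHomotopy :=
    ⟨by rw [← whiskerLeft_comp_assoc, I.bot_star, whiskerLeft_comp_assoc, down_tensorCopair,
          η.isHomotopy.source],
      by rw [← whiskerLeft_comp_assoc, I.top_star, whiskerLeft_comp_assoc, up_tensorCopair,
          γ.isHomotopy.target]⟩

theorem whisker_copair {A B X : E} (h k : I.C₁ ⟶ X) (w : I.top ≫ h = I.bot ≫ k)
    (t : A ⊗ X ⟶ B) :
    A ◁ I.copair h k w ≫ t = I.tensorCopair (A ◁ h ≫ t) (A ◁ k ≫ t)
      (by rw [← whiskerLeft_comp_assoc, ← whiskerLeft_comp_assoc, w]) := by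
  apply (I.tensorPushout A).hom_ext
  · rw [up_tensorCopair, ← whiskerLeft_comp_assoc, I.up_copair]
  · rw [down_tensorCopair, ← whiskerLeft_comp_assoc, I.down_copair]

theorem star_tensorCopair_assoc {A B : E} (η γ χ : A ⊗ I.C₁ ⟶ B)
    (w : A ◁ I.top ≫ η = A ◁ I.bot ≫ γ) (w' : A ◁ I.top ≫ γ = A ◁ I.bot ≫ χ) :
    A ◁ I.star ≫ I.tensorCopair η (A ◁ I.star ≫ I.tensorCopair γ χ w')
      (by rw [← whiskerLeft_comp_assoc, I.bot_star, whiskerLeft_comp_assoc,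
        down_tensorCopair, w]) =
    A ◁ I.star ≫ I.tensorCopair (A ◁ I.star ≫ I.tensorCopair η γ w) χ
      (by rw [← whiskerLeft_comp_assoc, I.top_star, whiskerLeft_comp_assoc,
        up_tensorCopair, w']) := by
  let P : IsPushout (A ◁ I.up) (A ◁ I.down) (A ◁ pushout.inl I.up I.down)
      (A ◁ pushout.inr I.up I.down) :=
    (IsPushout.of_hasPushout I.up I.down).map (tensorLeft A)
  have := congrArg (fun t => A ◁ t ≫
    P.desc (I.tensorCopair η γ w) (I.tensorCopair γ χ w') (by simp)) I.coassoc
  simpa only [whiskerLeft_comp, Category.assoc, whisker_copair, P.inl_desc, P.inr_desc,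
    down_tensorCopair, up_tensorCopair] using this

/-- The category structure on `E(A, B)`, with the 2-cells as morphisms. -/
noncomputable instance homCategory (A B : E) : Category (I.HomCat A B) where
  Hom := Homotopy
  id := Homotopy.refl
  comp := Homotopy.vcomp
  id_comp := by
    intro f g η
    apply Homotopy.ext
    have := congrArg (fun t => A ◁ t ≫ η.map) I.counit_bot
    simp only [whiskerLeft_comp, Category.assoc, whisker_copair, whiskerLeft_id,
      Category.id_comp, η.isHomotopy.source] at this
    exact this
  comp_id := by
    intro f g η
    apply Homotopy.ext
    have := congrArg (fun t => A ◁ t ≫ η.map) I.counit_top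
    simp only [whiskerLeft_comp, Category.assoc, whisker_copair, whiskerLeft_id,
      Category.id_comp, η.isHomotopy.target] at this
    exact this
  assoc := by
    intro f g h k η γ χ
    apply Homotopy.ext
    exact (star_tensorCopair_assoc η.map γ.map χ.map (η.glue γ) (γ.glue χ)).symm

/-- The composite of `u : A ⟶ B` and `f : B ⟶ C`, as an object of `E(A, C)`. -/
def HomCat.comp {A B C : E} (u : I.HomCat A B) (f : I.HomCat B C) : I.HomCat A C :=
  ⟨u.arrow ≫ f.arrow⟩

/-- Horizontal composition of `η : f ⇒ g` in `E(A, B)` and `γ : h ⇒ k` in `E(B, C)`: the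
composite of `A ⊗ Δ`, the associativity isomorphism, `η ⊗ I` and `γ`. -/
noncomputable def hcomp {A B C : E} {f g : I.HomCat A B} {h k : I.HomCat B C}
    (η : f ⟶ g) (γ : h ⟶ k) : f.comp h ⟶ g.comp k :=
  Homotopy.mk (A ◁ Δ[I.C₁] ≫ (α_ A I.C₁ I.C₁).inv ≫ Homotopy.map η ▷ I.C₁ ≫ Homotopy.map γ)
    ⟨by
      rw [← whiskerLeft_comp_assoc]
      exact hcomp_aux I.bot_diag η.isHomotopy.source γ.isHomotopy.source,
    by
      rw [← whiskerLeft_comp_assoc]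
      exact hcomp_aux I.top_diag η.isHomotopy.target γ.isHomotopy.target⟩

variable (I) in
/-- A cotensor of `A` with the arrow category `𝟚`: an object `pt` together with isomorphisms of
categories `E(B, pt) ≅ E(B, A)^𝟚` that are 2-natural in `B`. The category `E(B, A)^𝟚` is the
category of arrows and commutative squares in `E(B, A)`. -/
structure Cotensor (A : E) where
  /-- The cotensor object. -/
  pt : E
  /-- The isomorphisms of categories. -/
  toArrow (B : E) : I.HomCat B pt ⥤ Arrow (I.HomCat B A)
  /-- The inverses. -/
  ofArrow (B : E) : Arrow (I.HomCat B A) ⥤ I.HomCat B pt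
  toArrow_ofArrow (B : E) : toArrow B ⋙ ofArrow B = 𝟭 _
  ofArrow_toArrow (B : E) : ofArrow B ⋙ toArrow B = 𝟭 _
  /-- Compatibility with precomposition on objects. -/
  naturality_obj {B B' : E} (u : I.HomCat B' B) (f : I.HomCat B pt) :
    (toArrow B').obj (u.comp f) = Arrow.mk (hcomp (𝟙 u) ((toArrow B).obj f).hom)
  /-- Compatibility with precomposition on 2-cells, first component of the square. -/
  naturality_left {B B' : E} {u v : I.HomCat B' B} (β : u ⟶ v) {f g : I.HomCat B pt}
    (φ : f ⟶ g) : Homotopy.map ((toArrow B').map (hcomp β φ)).left =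
      Homotopy.map (hcomp β ((toArrow B).map φ).left)
  /-- Compatibility with precomposition on 2-cells, second component of the square. -/
  naturality_right {B B' : E} {u v : I.HomCat B' B} (β : u ⟶ v) {f g : I.HomCat B pt}
    (φ : f ⟶ g) : Homotopy.map ((toArrow B').map (hcomp β φ)).right =
      Homotopy.map (hcomp β ((toArrow B).map φ).right)

variable (I) in
/-- An interval is representable if all cotensors with `𝟚` exist with respect to the 2-cells
that it induces. -/
def IsRepresentable : Prop :=
  ∀ A : E, Nonempty (I.Cotensor A)

end TwoCells

end Interval

/-! ### Lattices in a symmetric monoidal category -/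

section Lattice

variable {E : Type u} [Category.{v} E] [MonoidalCategory E] [SymmetricCategory E]

/-- A lattice structure on a comonoid `L`. -/
structure IsLattice {L : E} [ComonObj L] (meet join : L ⊗ L ⟶ L) : Prop where
  meet_assoc : L ◁ meet ≫ meet = (α_ L L L).inv ≫ meet ▷ L ≫ meet
  join_assoc : L ◁ join ≫ join = (α_ L L L).inv ≫ join ▷ L ≫ join
  meet_comm : (β_ L L).hom ≫ meet = meet
  join_comm : (β_ L L).hom ≫ join = join
  meet_idem : Δ[L] ≫ meet = 𝟙 L
  join_idem : Δ[L] ≫ join = 𝟙 L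
  meet_absorb : Δ[L] ▷ L ≫ (α_ L L L).hom ≫ L ◁ join ≫ meet = L ◁ ε[L] ≫ (ρ_ L).hom
  join_absorb : Δ[L] ▷ L ≫ (α_ L L L).hom ≫ L ◁ meet ≫ join = L ◁ ε[L] ≫ (ρ_ L).hom

/-- A unital lattice structure: `top` is the unit for `meet`, `bot` is the unit for `join`, and
`bot`, `top` are absorbing for `meet`, `join` respectively. -/
structure IsUnitalLattice {L : E} [ComonObj L] (bot top : 𝟙_ E ⟶ L) (meet join : L ⊗ L ⟶ L) :
    Prop extends IsLattice meet join where
  meet_top : L ◁ top ≫ meet = (ρ_ L).hom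
  top_meet : top ▷ L ≫ meet = (λ_ L).hom
  join_bot : L ◁ bot ≫ join = (ρ_ L).hom
  bot_join : bot ▷ L ≫ join = (λ_ L).hom
  meet_bot : L ◁ bot ≫ meet = (ρ_ L).hom ≫ ε[L] ≫ bot
  bot_meet : bot ▷ L ≫ meet = (λ_ L).hom ≫ ε[L] ≫ bot
  join_top : L ◁ top ≫ join = (ρ_ L).hom ≫ ε[L] ≫ top
  top_join : top ▷ L ≫ join = (λ_ L).hom ≫ ε[L] ≫ top

/-- `op₁` distributes over `op₂`: the map `op₁ ∘ (L ⊗ op₂)` on `L ⊗ (L ⊗ L)` is obtained by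
duplicating the first factor with `Δ`, moving the outer copy past the second factor with the
symmetry, applying `op₁ ⊗ op₁`, and then `op₂`. -/
def Distributes {L : E} [ComonObj L] (op₁ op₂ : L ⊗ L ⟶ L) : Prop :=
  L ◁ op₂ ≫ op₁ =
    Δ[L] ▷ (L ⊗ L) ≫ (α_ (L ⊗ L) L L).inv ≫ (α_ L L L).hom ▷ L ≫ (β_ L (L ⊗ L)).hom ▷ L ≫
      (α_ (L ⊗ L) L L).hom ≫ (op₁ ⊗ₘ op₁) ≫ op₂

/-- A unital distributive lattice structure on a comonoid `L`. -/
structure IsUnitalDistribLattice {L : E} [ComonObj L] (bot top : 𝟙_ E ⟶ L)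
    (meet join : L ⊗ L ⟶ L) : Prop extends IsUnitalLattice bot top meet join where
  meet_distrib : Distributes meet join
  join_distrib : Distributes join meet

end Lattice

end RepInterval

/-!
Representability turns maps out of `(B ⊗ I) ⊗ I` into commutative squares. A map
`(B ⊗ I) ⊗ I ⟶ A` is a 2-cell on `B ⊗ I`, hence a map `B ⊗ I ⟶ P` into the cotensor of `A`, hence
a morphism of `E(B, A)^𝟚`; by 2-naturality the four sides of this square are the restrictions of
the original map along `⊥` and `⊤` in the two factors `I`. So a map is determined by its four faces
(`Cotensor.hom_ext`), and every commutative square is filled (`Cotensor.exists_filler`).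

The meet is the filler of the square in `E(U, I)` with sides `1_⊥`, `1_⊥`, `t`, `t`, where
`t : ⊥ ⇒ ⊤` is the interval itself, and the join is the filler of the square with sides `t`, `t`,
`1_⊤`, `1_⊤`. The unit and annihilation laws say exactly what the faces of these fillers are, and so
does the description by 2-cells; this gives uniqueness in both forms.

Every remaining law but idempotence is an equation between maps out of `I ⊗ I` or `I ⊗ (I ⊗ I)`.
Using the symmetry to move a spectator factor away (`facesJointlyEpic`), such an equation holds if
it holds when each of two variables is set to `⊥` or `⊤`, and there it reduces to unit and
annihilation laws, as in a truth table. The points `⊥` and `⊤` can be copied and discarded, which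
handles the variables duplicated by `Δ`. Idempotence holds because `Δ` is a composite path through
`(⊥, t)` and `(t, ⊤)`, whose image under either operation is a constant path composed with the
identity path. Exchanging `⊥` with `⊤` exchanges the two operations, so each law is proved once, for
an operation with an absorbing point `z` and a unit point `e`.
-/

namespace RepInterval

namespace Interval

/-! ### Homotopies and cotensors with the arrow category -/

section Cotensors

variable {E : Type u} [Category.{v} E] [MonoidalCategory E] [HasPushouts E]
  {I : Interval E}

theorem HomCat.ext {A B : E} {f g : I.HomCat A B} (h : f.arrow = g.arrow) : f = g := by
  cases f; cases g; cases h; rfl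

variable [MonoidalClosed E]

theorem id_map {A B : E} (f : I.HomCat A B) :
    Homotopy.map (𝟙 f) = A ◁ I.i ≫ (ρ_ A).hom ≫ f.arrow := rfl

theorem hcomp_map {A B C : E} {f g : I.HomCat A B} {h k : I.HomCat B C}
    (η : f ⟶ g) (γ : h ⟶ k) : Homotopy.map (hcomp η γ) =
      A ◁ Δ[I.C₁] ≫ (α_ A I.C₁ I.C₁).inv ≫ Homotopy.map η ▷ I.C₁ ≫ Homotopy.map γ := rfl

theorem hcomp_id_left_map {A B C : E} (u : I.HomCat A B) {h k : I.HomCat B C} (γ : h ⟶ k) :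
    Homotopy.map (hcomp (𝟙 u) γ) = u.arrow ▷ I.C₁ ≫ Homotopy.map γ := by
  rw [hcomp_map, id_map]
  have h1 : A ◁ Δ[I.C₁] ≫ (α_ A I.C₁ I.C₁).inv ≫ (A ◁ I.i) ▷ I.C₁ =
      A ◁ (λ_ I.C₁).inv ≫ (α_ A (𝟙_ E) I.C₁).inv := by
    rw [← ComonObj.counit_comul I.C₁, whiskerLeft_comp, Category.assoc,
      associator_inv_naturality_middle]
    rfl
  rw [comp_whiskerRight, Category.assoc, reassoc_of% h1]
  simp

theorem hcomp_id_right_map {A B C : E} {f g : I.HomCat A B} (η : f ⟶ g) (h : I.HomCat B C) :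
    Homotopy.map (hcomp η (𝟙 h)) = Homotopy.map η ≫ h.arrow := by
  rw [hcomp_map, id_map, ← whisker_exchange_assoc, ← associator_inv_naturality_right_assoc,
    ← whiskerLeft_comp_assoc]
  have h1 : Δ[I.C₁] ≫ I.C₁ ◁ I.i = (ρ_ I.C₁).inv := ComonObj.comul_counit I.C₁
  rw [h1]
  simp

/-- An object of `E(B, A)^𝟚` is determined by the underlying map of its 2-cell, since the source
and target of a 2-cell are recovered by restriction along `⊥` and `⊤`. -/
theorem arrow_ext {A B : E} {X Y : Arrow (I.HomCat B A)}
    (h : Homotopy.map X.hom = Homotopy.map Y.hom) : X = Y := by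
  obtain ⟨⟨a⟩, ⟨b⟩, η⟩ := X
  obtain ⟨⟨a'⟩, ⟨b'⟩, η'⟩ := Y
  obtain rfl : a = a' := by
    have h1 := (Homotopy.isHomotopy η).source
    rw [show Homotopy.map η = Homotopy.map η' from h, (Homotopy.isHomotopy η').source] at h1
    exact ((cancel_epi _).1 h1).symm
  obtain rfl : b = b' := by
    have h1 := (Homotopy.isHomotopy η).target
    rw [show Homotopy.map η = Homotopy.map η' from h, (Homotopy.isHomotopy η').target] at h1
    exact ((cancel_epi _).1 h1).symm
  obtain rfl : η = η' := Homotopy.ext h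
  rfl

/-- A map out of `A ⊗ I`, as a 2-cell between its restrictions along `⊥` and `⊤`. -/
noncomputable def toHomotopy {A B : E} (η : A ⊗ I.C₁ ⟶ B) :
    (⟨(ρ_ A).inv ≫ A ◁ I.bot ≫ η⟩ : I.HomCat A B) ⟶ ⟨(ρ_ A).inv ≫ A ◁ I.top ≫ η⟩ :=
  Homotopy.mk η ⟨by simp, by simp⟩

namespace Cotensor

variable {A : E} (c : I.Cotensor A)

/-- The generic 2-cell on a cotensor, which corresponds to the identity map. -/
noncomputable def generic : c.pt ⊗ I.C₁ ⟶ A :=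
  Homotopy.map ((c.toArrow c.pt).obj ⟨𝟙 c.pt⟩).hom

theorem toArrow_obj {B : E} (u : I.HomCat B c.pt) :
    Homotopy.map ((c.toArrow B).obj u).hom = u.arrow ▷ I.C₁ ≫ c.generic := by
  have h := c.naturality_obj u ⟨𝟙 c.pt⟩
  rw [show u.comp ⟨𝟙 c.pt⟩ = u from HomCat.ext (Category.comp_id _)] at h
  rw [h]
  exact hcomp_id_left_map u _

/-- The underlying maps of the components of `toArrow.map η` depend only on the underlying map of
`η` once its source and target are known up to propositional equality. -/
theorem toArrow_map_congr {B : E} {f g f' g' : I.HomCat B c.pt} (η : f ⟶ g) (η' : f' ⟶ g')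
    (hf : f = f') (hg : g = g') (h : Homotopy.map η = Homotopy.map η') :
    Homotopy.map ((c.toArrow B).map η).left = Homotopy.map ((c.toArrow B).map η').left ∧
    Homotopy.map ((c.toArrow B).map η).right = Homotopy.map ((c.toArrow B).map η').right := by
  subst hf hg
  obtain rfl : η = η' := Homotopy.ext h
  exact ⟨rfl, rfl⟩

/-- The components of the square of a 2-cell `η` into the cotensor are the remaining two faces of
the map `(η ⊗ I) ≫ generic`; this is 2-naturality at `η * 1` with the identity of `P`. -/
theorem toArrow_map_left {B : E} {f g : I.HomCat B c.pt} (η : f ⟶ g) :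
    Homotopy.map ((c.toArrow B).map η).left =
      (ρ_ _).inv ≫ (B ⊗ I.C₁) ◁ I.bot ≫ Homotopy.map η ▷ I.C₁ ≫ c.generic := by
  have h := c.naturality_left η (𝟙 ⟨𝟙 c.pt⟩)
  rw [CategoryTheory.Functor.map_id, Arrow.id_left, hcomp_id_right_map] at h
  rw [(c.toArrow_map_congr η (hcomp η (𝟙 ⟨𝟙 c.pt⟩)) (HomCat.ext (Category.comp_id _).symm)
    (HomCat.ext (Category.comp_id _).symm)
    (by rw [hcomp_id_right_map]; exact (Category.comp_id _).symm)).1, h,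
    whisker_exchange_assoc, generic, (Homotopy.isHomotopy _).source]
  simp

theorem toArrow_map_right {B : E} {f g : I.HomCat B c.pt} (η : f ⟶ g) :
    Homotopy.map ((c.toArrow B).map η).right =
      (ρ_ _).inv ≫ (B ⊗ I.C₁) ◁ I.top ≫ Homotopy.map η ▷ I.C₁ ≫ c.generic := by
  have h := c.naturality_right η (𝟙 ⟨𝟙 c.pt⟩)
  rw [CategoryTheory.Functor.map_id, Arrow.id_right, hcomp_id_right_map] at h
  rw [(c.toArrow_map_congr η (hcomp η (𝟙 ⟨𝟙 c.pt⟩)) (HomCat.ext (Category.comp_id _).symm)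
    (HomCat.ext (Category.comp_id _).symm)
    (by rw [hcomp_id_right_map]; exact (Category.comp_id _).symm)).2, h,
    whisker_exchange_assoc, generic, (Homotopy.isHomotopy _).target]
  simp

/-- Every 2-cell is pulled back from the generic one along some map, which
`classifier_injective` shows to be unique. -/
theorem exists_classifier {B : E} (η : B ⊗ I.C₁ ⟶ A) :
    ∃ u : B ⟶ c.pt, u ▷ I.C₁ ≫ c.generic = η := by
  refine ⟨((c.ofArrow B).obj (Arrow.mk (toHomotopy η))).arrow, ?_⟩
  rw [← c.toArrow_obj]
  have h : (c.toArrow B).obj ((c.ofArrow B).obj (Arrow.mk (toHomotopy η))) = _ :=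
    Functor.congr_obj (c.ofArrow_toArrow B) _
  rw [h]
  rfl

theorem classifier_injective {B : E} {u u' : B ⟶ c.pt}
    (h : u ▷ I.C₁ ≫ c.generic = u' ▷ I.C₁ ≫ c.generic) : u = u' := by
  have h1 : (c.toArrow B).obj ⟨u⟩ = (c.toArrow B).obj ⟨u'⟩ :=
    arrow_ext (by rw [c.toArrow_obj, c.toArrow_obj, h])
  have h2 (w : B ⟶ c.pt) : (c.ofArrow B).obj ((c.toArrow B).obj ⟨w⟩) = ⟨w⟩ :=
    Functor.congr_obj (c.toArrow_ofArrow B) _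
  have h3 := h2 u
  rw [h1, h2 u'] at h3
  exact congrArg HomCat.arrow h3.symm

theorem toArrow_map_injective {B : E} {f g : I.HomCat B c.pt} {η η' : f ⟶ g}
    (h : (c.toArrow B).map η = (c.toArrow B).map η') : η = η' := by
  have hF : ∀ F : I.HomCat B c.pt ⥤ I.HomCat B c.pt, F = 𝟭 _ → F.map η = F.map η' → η = η' := by
    rintro _ rfl h
    exact h
  exact hF _ (c.toArrow_ofArrow B) (congrArg (c.ofArrow B).map h)

/-- A map out of `(B ⊗ I) ⊗ I` is determined by its four faces: through the cotensor it is a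
2-cell into `P`, hence a morphism of `E(B, A)^𝟚`, and the faces are the four sides of that
square. -/
theorem hom_ext (c : I.Cotensor A) {B : E} {f g : (B ⊗ I.C₁) ⊗ I.C₁ ⟶ A}
    (h₁ : (B ◁ I.bot) ▷ I.C₁ ≫ f = (B ◁ I.bot) ▷ I.C₁ ≫ g)
    (h₂ : (B ◁ I.top) ▷ I.C₁ ≫ f = (B ◁ I.top) ▷ I.C₁ ≫ g)
    (h₃ : (B ⊗ I.C₁) ◁ I.bot ≫ f = (B ⊗ I.C₁) ◁ I.bot ≫ g)
    (h₄ : (B ⊗ I.C₁) ◁ I.top ≫ f = (B ⊗ I.C₁) ◁ I.top ≫ g) : f = g := by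
  obtain ⟨x, rfl⟩ := c.exists_classifier f
  obtain ⟨y, rfl⟩ := c.exists_classifier g
  have e₁ : B ◁ I.bot ≫ x = B ◁ I.bot ≫ y :=
    c.classifier_injective (by simpa only [comp_whiskerRight, Category.assoc] using h₁)
  have e₂ : B ◁ I.top ≫ x = B ◁ I.top ≫ y :=
    c.classifier_injective (by simpa only [comp_whiskerRight, Category.assoc] using h₂)
  let X := toHomotopy x
  let Y : (⟨(ρ_ B).inv ≫ B ◁ I.bot ≫ x⟩ : I.HomCat B c.pt) ⟶ ⟨(ρ_ B).inv ≫ B ◁ I.top ≫ x⟩ :=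
    Homotopy.mk y ⟨by simp [e₁], by simp [e₂]⟩
  have hXY : X = Y := by
    refine c.toArrow_map_injective (Arrow.hom_ext _ _ (Homotopy.ext ?_) (Homotopy.ext ?_))
    · refine (c.toArrow_map_left X).trans (Eq.trans ?_ (c.toArrow_map_left Y).symm)
      exact congrArg _ h₃
    · refine (c.toArrow_map_right X).trans (Eq.trans ?_ (c.toArrow_map_right Y).symm)
      exact congrArg _ h₄
  have hxy : x = y := congrArg Homotopy.map hXY
  rw [hxy]

/-- Every commutative square in `E(B, A)` is filled by a map out of `(B ⊗ I) ⊗ I`. -/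
theorem exists_filler (c : I.Cotensor A) {B : E} {X Y : Arrow (I.HomCat B A)} (s : X ⟶ Y) :
    ∃ f : (B ⊗ I.C₁) ⊗ I.C₁ ⟶ A,
      (B ◁ I.bot) ▷ I.C₁ ≫ f = (ρ_ B).hom ▷ I.C₁ ≫ Homotopy.map X.hom ∧
      (B ◁ I.top) ▷ I.C₁ ≫ f = (ρ_ B).hom ▷ I.C₁ ≫ Homotopy.map Y.hom ∧
      (B ⊗ I.C₁) ◁ I.bot ≫ f = (ρ_ _).hom ≫ Homotopy.map s.left ∧
      (B ⊗ I.C₁) ◁ I.top ≫ f = (ρ_ _).hom ≫ Homotopy.map s.right := by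
  let η := (c.ofArrow B).map s
  have hobj (Z : Arrow (I.HomCat B A)) :
      ((c.ofArrow B).obj Z).arrow ▷ I.C₁ ≫ c.generic = Homotopy.map Z.hom := by
    rw [← c.toArrow_obj]
    have h : (c.toArrow B).obj ((c.ofArrow B).obj Z) = Z :=
      Functor.congr_obj (c.ofArrow_toArrow B) Z
    rw [h]
  have hF : ∀ F : Arrow (I.HomCat B A) ⥤ Arrow (I.HomCat B A), F = 𝟭 _ →
      Homotopy.map (F.map s).left = Homotopy.map s.left ∧
      Homotopy.map (F.map s).right = Homotopy.map s.right := by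
    rintro _ rfl
    exact ⟨rfl, rfl⟩
  obtain ⟨hl, hr⟩ := hF _ (c.ofArrow_toArrow B)
  refine ⟨Homotopy.map η ▷ I.C₁ ≫ c.generic, ?_, ?_, ?_, ?_⟩
  · rw [← comp_whiskerRight_assoc, (Homotopy.isHomotopy η).source, comp_whiskerRight_assoc, hobj]
  · rw [← comp_whiskerRight_assoc, (Homotopy.isHomotopy η).target, comp_whiskerRight_assoc, hobj]
  · rw [← hl, ← Iso.inv_comp_eq]
    exact (c.toArrow_map_left η).symm
  · rw [← hr, ← Iso.inv_comp_eq]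
    exact (c.toArrow_map_right η).symm

end Cotensor

end Cotensors

end Interval

/-! ### Bounded operations on a comonoid with jointly epic faces -/

section LatticeFromFaces

variable {E : Type u} [Category.{v} E] [MonoidalCategory E]

/-- Two points `z` and `e` of `L` have jointly epic faces if a map out of `L ⊗ (L ⊗ C)` is
determined by its restrictions along `z` and `e` in each of the two factors `L`. The object `C` is
a spectator: it is the unit for binary operations and `L` for ternary ones. -/
def FacesJointlyEpic {L : E} (z e : 𝟙_ E ⟶ L) : Prop :=
  ∀ ⦃C A : E⦄ ⦃f g : L ⊗ (L ⊗ C) ⟶ A⦄, z ▷ (L ⊗ C) ≫ f = z ▷ (L ⊗ C) ≫ g →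
    e ▷ (L ⊗ C) ≫ f = e ▷ (L ⊗ C) ≫ g → L ◁ z ▷ C ≫ f = L ◁ z ▷ C ≫ g →
    L ◁ e ▷ C ≫ f = L ◁ e ▷ C ≫ g → f = g

/-- A binary operation on a comonoid with absorbing element `z` and unit `e`. -/
structure IsBoundedOp {L : E} [ComonObj L] (z e : 𝟙_ E ⟶ L) (op : L ⊗ L ⟶ L) : Prop where
  zero_left : z ▷ L ≫ op = (λ_ L).hom ≫ ε[L] ≫ z
  zero_right : L ◁ z ≫ op = (ρ_ L).hom ≫ ε[L] ≫ z
  unit_left : e ▷ L ≫ op = (λ_ L).hom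
  unit_right : L ◁ e ≫ op = (ρ_ L).hom

variable {L : E}

theorem FacesJointlyEpic.symm {z e : 𝟙_ E ⟶ L} (h : FacesJointlyEpic z e) :
    FacesJointlyEpic e z :=
  fun _ _ _ _ h₁ h₂ h₃ h₄ => h h₂ h₁ h₄ h₃

theorem FacesJointlyEpic.hom_ext {z e : 𝟙_ E ⟶ L} (h : FacesJointlyEpic z e) {A : E}
    {f g : L ⊗ L ⟶ A} (h₁ : z ▷ L ≫ f = z ▷ L ≫ g) (h₂ : e ▷ L ≫ f = e ▷ L ≫ g)
    (h₃ : L ◁ z ≫ f = L ◁ z ≫ g) (h₄ : L ◁ e ≫ f = L ◁ e ≫ g) : f = g := by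
  rw [← cancel_epi (L ◁ (ρ_ L).hom)]
  apply h
  · rw [← whisker_exchange_assoc, ← whisker_exchange_assoc, h₁]
  · rw [← whisker_exchange_assoc, ← whisker_exchange_assoc, h₂]
  · rw [← whiskerLeft_comp_assoc, ← whiskerLeft_comp_assoc, rightUnitor_naturality,
      whiskerLeft_comp_assoc, whiskerLeft_comp_assoc, h₃]
  · rw [← whiskerLeft_comp_assoc, ← whiskerLeft_comp_assoc, rightUnitor_naturality,
      whiskerLeft_comp_assoc, whiskerLeft_comp_assoc, h₄]

/-- Restricting the copied variable to a point turns both copies into that point. -/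
theorem point_whisker_copy {z : 𝟙_ E ⟶ L} {δ : L ⟶ L ⊗ L}
    (hz : z ≫ δ = (λ_ (𝟙_ E)).inv ≫ (z ⊗ₘ z)) (C : E) :
    z ▷ C ≫ δ ▷ C ≫ (α_ L L C).hom =
      z ▷ C ≫ (λ_ (L ⊗ C)).inv ≫ z ▷ (L ⊗ C) := by
  rw [← comp_whiskerRight_assoc, hz, MonoidalCategory.tensorHom_def']
  simp only [comp_whiskerRight, Category.assoc, associator_naturality_left,
    associator_naturality_middle_assoc]
  rw [leftUnitor_inv_naturality_assoc]
  monoidal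

variable [ComonObj L]

/-- A point of a comonoid that is compatible with the counit and the comultiplication, so that it
can be discarded and copied. -/
structure IsGrouplike (z : 𝟙_ E ⟶ L) : Prop where
  comp_counit : z ≫ ε[L] = 𝟙 (𝟙_ E)
  comp_comul : z ≫ Δ[L] = (λ_ (𝟙_ E)).inv ≫ (z ⊗ₘ z)

variable {z e : 𝟙_ E ⟶ L} {m j : L ⊗ L ⟶ L}

/-- An operation with the given absorbing element and unit is unique, as its faces are
prescribed. -/
theorem IsBoundedOp.unique (h : FacesJointlyEpic z e) {m' : L ⊗ L ⟶ L} (hm : IsBoundedOp z e m)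
    (hm' : IsBoundedOp z e m') : m = m' :=
  h.hom_ext (by rw [hm.zero_left, hm'.zero_left]) (by rw [hm.unit_left, hm'.unit_left])
    (by rw [hm.zero_right, hm'.zero_right]) (by rw [hm.unit_right, hm'.unit_right])

/-- Discarding the result of an operation discards both arguments. This compatibility with the
counit is not assumed but follows from the faces. -/
theorem IsBoundedOp.comp_counit (h : FacesJointlyEpic z e) (hz : IsGrouplike z)
    (he : IsGrouplike e) (hm : IsBoundedOp z e m) :
    m ≫ ε[L] = (ε[L] ⊗ₘ ε[L]) ≫ (λ_ (𝟙_ E)).hom := by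
  apply h.hom_ext
  · rw [reassoc_of% hm.zero_left, hz.comp_counit, MonoidalCategory.tensorHom_def, Category.assoc,
      ← comp_whiskerRight_assoc, hz.comp_counit]
    simp
  · rw [reassoc_of% hm.unit_left, MonoidalCategory.tensorHom_def, Category.assoc,
      ← comp_whiskerRight_assoc, he.comp_counit]
    simp
  · rw [reassoc_of% hm.zero_right, hz.comp_counit, MonoidalCategory.tensorHom_def', Category.assoc,
      ← whiskerLeft_comp_assoc, hz.comp_counit]
    simp [unitors_equal]
  · rw [reassoc_of% hm.unit_right, MonoidalCategory.tensorHom_def', Category.assoc,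
      ← whiskerLeft_comp_assoc, he.comp_counit]
    simp [unitors_equal]

theorem whisker_counit_comm : L ◁ ε[L] ≫ (ρ_ L).hom ≫ ε[L] = ε[L] ▷ L ≫ (λ_ L).hom ≫ ε[L] := by
  rw [← rightUnitor_naturality, ← leftUnitor_naturality, whisker_exchange_assoc, unitors_equal]

theorem IsBoundedOp.assoc (h : FacesJointlyEpic z e) (hz : IsGrouplike z)
    (he : IsGrouplike e) (hm : IsBoundedOp z e m) :
    L ◁ m ≫ m = (α_ L L L).inv ≫ m ▷ L ≫ m := by
  apply h
  · rw [← whisker_exchange_assoc, hm.zero_left, leftUnitor_naturality_assoc,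
      reassoc_of% hm.comp_counit h hz he, associator_inv_naturality_left_assoc,
      ← comp_whiskerRight_assoc, hm.zero_left]
    simp only [comp_whiskerRight, Category.assoc, hm.zero_left, MonoidalCategory.tensorHom_def]
    simp
  · rw [← whisker_exchange_assoc, hm.unit_left, leftUnitor_naturality,
      associator_inv_naturality_left_assoc, ← comp_whiskerRight_assoc, hm.unit_left]
    simp
  · rw [← whiskerLeft_comp_assoc, hm.zero_left, associator_inv_naturality_middle_assoc,
      ← comp_whiskerRight_assoc, hm.zero_right]
    simp only [comp_whiskerRight, whiskerLeft_comp, Category.assoc, hm.zero_left, hm.zero_right]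
    simp [reassoc_of% whisker_counit_comm (L := L)]
  · rw [← whiskerLeft_comp_assoc, hm.unit_left, associator_inv_naturality_middle_assoc,
      ← comp_whiskerRight_assoc, hm.unit_right]
    simp

/-- The absorption law. It is stated for an arbitrary copying map `δ`, since distributivity uses
it for the comultiplication followed by the symmetry. -/
theorem IsBoundedOp.absorb (h : FacesJointlyEpic z e) (hz : z ≫ ε[L] = 𝟙 _)
    (he : e ≫ ε[L] = 𝟙 _) {δ : L ⟶ L ⊗ L} (hzz : z ≫ δ = (λ_ (𝟙_ E)).inv ≫ (z ⊗ₘ z))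
    (hee : e ≫ δ = (λ_ (𝟙_ E)).inv ≫ (e ⊗ₘ e)) (hδ : δ ≫ L ◁ ε[L] = (ρ_ L).inv)
    (hm : IsBoundedOp z e m) (hj : IsBoundedOp e z j) (hidem : δ ≫ m = 𝟙 L) :
    δ ▷ L ≫ (α_ L L L).hom ≫ L ◁ j ≫ m = L ◁ ε[L] ≫ (ρ_ L).hom := by
  apply h.hom_ext
  · rw [reassoc_of% point_whisker_copy hzz, ← whisker_exchange_assoc, hm.zero_left,
      leftUnitor_naturality_assoc, Iso.inv_hom_id_assoc, reassoc_of% hj.unit_left,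
      ← whisker_exchange_assoc]
    simp [← unitors_equal]
  · rw [reassoc_of% point_whisker_copy hee, ← whisker_exchange_assoc, hm.unit_left,
      leftUnitor_naturality, Iso.inv_hom_id_assoc, hj.zero_left, ← whisker_exchange_assoc]
    simp [← unitors_equal]
  · rw [whisker_exchange_assoc, associator_naturality_right_assoc, ← whiskerLeft_comp_assoc,
      hj.unit_right, ← whiskerLeft_comp_assoc, hz]
    simp [hidem]
  · rw [whisker_exchange_assoc, associator_naturality_right_assoc, ← whiskerLeft_comp_assoc,
      hj.zero_right, ← whiskerLeft_comp_assoc, he]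
    simp [hm.unit_right, reassoc_of% hδ]

end LatticeFromFaces

/-! ### Commutativity and distributivity -/

section Symmetric

variable {E : Type u} [Category.{v} E] [MonoidalCategory E] [SymmetricCategory E]

/-- The middle part of the distributivity law: the rearrangement `((w, x), (y, z)) ↦
((x, y), (w, z))`. -/
def shuffle (W X Y Z : E) : (W ⊗ X) ⊗ (Y ⊗ Z) ⟶ (X ⊗ Y) ⊗ (W ⊗ Z) :=
  (α_ (W ⊗ X) Y Z).inv ≫ (α_ W X Y).hom ▷ Z ≫ (β_ W (X ⊗ Y)).hom ▷ Z ≫ (α_ (X ⊗ Y) W Z).hom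

theorem shuffle_naturality {W X Y Z W' X' Y' Z' : E} (a : W ⟶ W') (b : X ⟶ X') (c : Y ⟶ Y')
    (d : Z ⟶ Z') : ((a ⊗ₘ b) ⊗ₘ (c ⊗ₘ d)) ≫ shuffle W' X' Y' Z' =
      shuffle W X Y Z ≫ ((b ⊗ₘ c) ⊗ₘ (a ⊗ₘ d)) := by
  simp only [shuffle, Category.assoc]
  rw [associator_inv_naturality_assoc, ← associator_naturality]
  simp only [← tensorHom_id, tensorHom_comp_tensorHom_assoc, Category.id_comp, Category.comp_id]
  rw [associator_naturality_assoc, BraidedCategory.braiding_naturality]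

theorem shuffle_leftUnitor (Y Z : E) :
    shuffle (𝟙_ E) (𝟙_ E) Y Z ≫ ((λ_ Y).hom ⊗ₘ (λ_ Z).hom) =
      (λ_ (𝟙_ E)).hom ▷ (Y ⊗ Z) ≫ (λ_ (Y ⊗ Z)).hom := by
  simp [shuffle, MonoidalCategory.tensorHom_def]

theorem shuffle_rightUnitor (W X Z : E) :
    shuffle W X (𝟙_ E) Z ≫ (ρ_ X).hom ▷ (W ⊗ Z) =
      (W ⊗ X) ◁ (λ_ Z).hom ≫ (β_ W X).hom ▷ Z ≫ (α_ X W Z).hom := by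
  simp [shuffle]

theorem shuffle_naturality_third {W X Y Y' Z : E} (f : Y ⟶ Y') :
    (W ⊗ X) ◁ f ▷ Z ≫ shuffle W X Y' Z = shuffle W X Y Z ≫ (X ◁ f) ▷ (W ⊗ Z) := by
  simpa using shuffle_naturality (𝟙 W) (𝟙 X) f (𝟙 Z)

variable {L : E} [ComonObj L] {z e : 𝟙_ E ⟶ L} {m j : L ⊗ L ⟶ L}

theorem distributes_iff : Distributes m j ↔
    L ◁ j ≫ m = Δ[L] ▷ (L ⊗ L) ≫ shuffle L L L L ≫ (m ⊗ₘ m) ≫ j := by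
  simp [Distributes, shuffle]

theorem IsBoundedOp.braiding (hm : IsBoundedOp z e m) : IsBoundedOp z e ((β_ L L).hom ≫ m) where
  zero_left := by
    rw [BraidedCategory.braiding_naturality_left_assoc, hm.zero_right]
    simp
  zero_right := by
    rw [BraidedCategory.braiding_naturality_right_assoc, hm.zero_left]
    simp
  unit_left := by
    rw [BraidedCategory.braiding_naturality_left_assoc, hm.unit_right]
    simp
  unit_right := by
    rw [BraidedCategory.braiding_naturality_right_assoc, hm.unit_left]
    simp

theorem IsBoundedOp.comm (h : FacesJointlyEpic z e) (hm : IsBoundedOp z e m) :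
    (β_ L L).hom ≫ m = m :=
  hm.braiding.unique h hm

/-- Restricting the copied variable of the distributivity law to a point. -/
theorem point_distrib (hz : IsGrouplike z) {f : L ⟶ L} (hf : z ▷ L ≫ m = (λ_ L).hom ≫ f) :
    z ▷ (L ⊗ L) ≫ Δ[L] ▷ (L ⊗ L) ≫ shuffle L L L L ≫ (m ⊗ₘ m) ≫ j =
      (λ_ (L ⊗ L)).hom ≫ (f ⊗ₘ f) ≫ j := by
  have h1 : (z ⊗ₘ z) ▷ (L ⊗ L) ≫ shuffle L L L L =
      shuffle _ _ L L ≫ (z ▷ L ⊗ₘ z ▷ L) := by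
    simpa using shuffle_naturality z z (𝟙 L) (𝟙 L)
  rw [← comp_whiskerRight_assoc, hz.comp_comul, comp_whiskerRight_assoc, reassoc_of% h1,
    tensorHom_comp_tensorHom_assoc, hf, ← tensorHom_comp_tensorHom_assoc,
    reassoc_of% shuffle_leftUnitor]
  simp

/-- Restricting the middle variable of the distributivity law to a point. The two copies of the
first variable end up swapped. -/
theorem middle_point_distrib {f : L ⟶ L} (hf : L ◁ z ≫ m = (ρ_ L).hom ≫ f) :
    L ◁ z ▷ L ≫ Δ[L] ▷ (L ⊗ L) ≫ shuffle L L L L ≫ (m ⊗ₘ m) ≫ j =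
      L ◁ (λ_ L).hom ≫ (Δ[L] ≫ (β_ L L).hom) ▷ L ≫ (α_ L L L).hom ≫ f ▷ (L ⊗ L) ≫ L ◁ m ≫ j := by
  rw [whisker_exchange_assoc, reassoc_of% shuffle_naturality_third z,
    MonoidalCategory.tensorHom_def, Category.assoc, ← comp_whiskerRight_assoc, hf,
    comp_whiskerRight_assoc, reassoc_of% shuffle_rightUnitor, ← whisker_exchange_assoc]
  simp

/-- Distributivity, checked on the faces of the first and the middle variable. Setting the middle
variable to the unit of `m` leaves an instance of the absorption law in which the copies of the
first variable are swapped. -/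
theorem IsBoundedOp.distributes (h : FacesJointlyEpic z e) (hz : IsGrouplike z)
    (he : IsGrouplike e) (hm : IsBoundedOp z e m) (hj : IsBoundedOp e z j)
    (hidem : Δ[L] ≫ j = 𝟙 L) : Distributes m j := by
  have hcopy : (Δ[L] ≫ (β_ L L).hom) ≫ L ◁ ε[L] = (ρ_ L).inv := by
    have h1 : Δ[L] ≫ ε[L] ▷ L = (λ_ L).inv := ComonObj.counit_comul L
    rw [Category.assoc, ← BraidedCategory.braiding_naturality_left, reassoc_of% h1]
    simp
  have hcopy' : (Δ[L] ≫ (β_ L L).hom) ≫ ε[L] ▷ L = (λ_ L).inv := by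
    have h1 : Δ[L] ≫ L ◁ ε[L] = (ρ_ L).inv := ComonObj.comul_counit L
    rw [Category.assoc, ← BraidedCategory.braiding_naturality_right, reassoc_of% h1]
    simp
  have hpoint (p : 𝟙_ E ⟶ L) (hp : IsGrouplike p) :
      p ≫ Δ[L] ≫ (β_ L L).hom = (λ_ (𝟙_ E)).inv ≫ (p ⊗ₘ p) := by
    rw [reassoc_of% hp.comp_comul, BraidedCategory.braiding_naturality]
    simp [unitors_inv_equal]
  rw [distributes_iff]
  apply h
  · rw [point_distrib hz hm.zero_left, ← whisker_exchange_assoc, hm.zero_left,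
      leftUnitor_naturality_assoc, reassoc_of% hj.comp_counit h.symm he hz,
      ← tensorHom_comp_tensorHom_assoc, MonoidalCategory.tensorHom_def' z z, Category.assoc,
      hj.unit_left, leftUnitor_naturality]
  · rw [point_distrib he (f := 𝟙 L) (by rw [hm.unit_left, Category.comp_id]),
      ← whisker_exchange_assoc, hm.unit_left, leftUnitor_naturality]
    simp
  · rw [middle_point_distrib hm.zero_right, ← whiskerLeft_comp_assoc, hj.unit_left,
      comp_whiskerRight_assoc ε[L], ← whisker_exchange_assoc z, hj.unit_left,
      ← associator_naturality_left_assoc, ← comp_whiskerRight_assoc, hcopy']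
    simp
  · rw [middle_point_distrib (f := 𝟙 L) (by rw [hm.unit_right, Category.comp_id]),
      ← whiskerLeft_comp_assoc, hj.zero_left, id_whiskerRight, Category.id_comp,
      hj.absorb h.symm he.comp_counit hz.comp_counit (hpoint e he) (hpoint z hz) hcopy hm
        (by rw [Category.assoc, hj.comm h.symm, hidem])]
    simp [hm.unit_right]

theorem IsBoundedOp.isUnitalDistribLattice (h : FacesJointlyEpic z e) (hz : IsGrouplike z)
    (he : IsGrouplike e) (hm : IsBoundedOp z e m) (hj : IsBoundedOp e z j)
    (hmi : Δ[L] ≫ m = 𝟙 L) (hji : Δ[L] ≫ j = 𝟙 L) : IsUnitalDistribLattice z e m j where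
  meet_assoc := hm.assoc h hz he
  join_assoc := hj.assoc h.symm he hz
  meet_comm := hm.comm h
  join_comm := hj.comm h.symm
  meet_idem := hmi
  join_idem := hji
  meet_absorb := hm.absorb h hz.comp_counit he.comp_counit hz.comp_comul he.comp_comul
    (ComonObj.comul_counit L) hj hmi
  join_absorb := hj.absorb h.symm he.comp_counit hz.comp_counit he.comp_comul hz.comp_comul
    (ComonObj.comul_counit L) hm hji
  meet_top := hm.unit_right
  top_meet := hm.unit_left
  join_bot := hj.unit_right
  bot_join := hj.unit_left
  meet_bot := hm.zero_right
  bot_meet := hm.zero_left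
  join_top := hj.zero_right
  top_join := hj.zero_left
  meet_distrib := hm.distributes h hz he hj hji
  join_distrib := hj.distributes h.symm he hz hm hmi

theorem IsUnitalLattice.isBoundedOp_meet (h : IsUnitalLattice z e m j) : IsBoundedOp z e m :=
  ⟨h.bot_meet, h.meet_bot, h.top_meet, h.meet_top⟩

theorem IsUnitalLattice.isBoundedOp_join (h : IsUnitalLattice z e m j) : IsBoundedOp e z j :=
  ⟨h.top_join, h.join_top, h.bot_join, h.join_bot⟩

end Symmetric

namespace Interval

/-! ### The lattice operations of a representable interval -/

section Comonoid

variable {E : Type u} [Category.{v} E] [MonoidalCategory E] [HasPushouts E] (I : Interval E)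

theorem isGrouplike_bot : IsGrouplike I.bot := ⟨I.bot_i, I.bot_diag⟩

theorem isGrouplike_top : IsGrouplike I.top := ⟨I.top_i, I.top_diag⟩

variable {I}

/-- Along the path `Δ`, which runs through `(⊥, t)` and then `(t, ⊤)`, the meet is the constant
path at `⊥` followed by the identity path. -/
theorem diag_meet {m : I.C₁ ⊗ I.C₁ ⟶ I.C₁} (hm : IsBoundedOp I.bot I.top m) :
    Δ[I.C₁] ≫ m = 𝟙 I.C₁ := by
  refine Eq.trans ?_ I.counit_bot
  change I.diag ≫ m = _
  have h1 : ((λ_ I.C₁).inv ≫ I.bot ▷ I.C₁) ≫ m = I.i ≫ I.bot := by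
    rw [Category.assoc, hm.zero_left, Iso.inv_hom_id_assoc]
    rfl
  have h2 : ((ρ_ I.C₁).inv ≫ I.C₁ ◁ I.top) ≫ m = 𝟙 I.C₁ := by
    rw [Category.assoc, hm.unit_right, Iso.inv_hom_id]
  rw [diag, Category.assoc, copair_comp]
  simp only [h1, h2]

theorem diag_join {j : I.C₁ ⊗ I.C₁ ⟶ I.C₁} (hj : IsBoundedOp I.top I.bot j) :
    Δ[I.C₁] ≫ j = 𝟙 I.C₁ := by
  refine Eq.trans ?_ I.counit_top
  change I.diag ≫ j = _
  have h1 : ((λ_ I.C₁).inv ≫ I.bot ▷ I.C₁) ≫ j = 𝟙 I.C₁ := by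
    rw [Category.assoc, hj.unit_left, Iso.inv_hom_id]
  have h2 : ((ρ_ I.C₁).inv ≫ I.C₁ ◁ I.top) ≫ j = I.i ≫ I.top := by
    rw [Category.assoc, hj.zero_right, Iso.inv_hom_id_assoc]
    rfl
  rw [diag, Category.assoc, copair_comp]
  simp only [h1, h2]

end Comonoid

section Representable

variable {E : Type u} [Category.{v} E] [MonoidalCategory E] [HasPushouts E] [MonoidalClosed E]
  {I : Interval E}

/-- A commutative square in `E(U, I)`, described by its four sides, is filled by a map out of
`I ⊗ I`. -/
theorem exists_square (hI : I.IsRepresentable) {X Y : Arrow (I.HomCat (𝟙_ E) I.C₁)} (s : X ⟶ Y) :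
    ∃ f : I.C₁ ⊗ I.C₁ ⟶ I.C₁,
      I.bot ▷ I.C₁ ≫ f = Homotopy.map X.hom ∧ I.top ▷ I.C₁ ≫ f = Homotopy.map Y.hom ∧
      I.C₁ ◁ I.bot ≫ f = (ρ_ _).hom ≫ (λ_ _).inv ≫ Homotopy.map s.left ∧
      I.C₁ ◁ I.top ≫ f = (ρ_ _).hom ≫ (λ_ _).inv ≫ Homotopy.map s.right := by
  obtain ⟨c⟩ := hI I.C₁
  obtain ⟨f, h₁, h₂, h₃, h₄⟩ := c.exists_filler s
  have hp (p : 𝟙_ E ⟶ I.C₁) {g : 𝟙_ E ⊗ I.C₁ ⟶ I.C₁}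
      (h : (𝟙_ E ◁ p) ▷ I.C₁ ≫ f = (ρ_ (𝟙_ E)).hom ▷ I.C₁ ≫ g) :
      p ▷ I.C₁ ≫ (λ_ I.C₁).inv ▷ I.C₁ ≫ f = g := by
    rw [← comp_whiskerRight_assoc, leftUnitor_inv_naturality, comp_whiskerRight_assoc, h,
      ← comp_whiskerRight_assoc, ← unitors_equal, Iso.inv_hom_id]
    simp
  refine ⟨(λ_ I.C₁).inv ▷ I.C₁ ≫ f, hp _ h₁, hp _ h₂, ?_, ?_⟩
  · rw [whisker_exchange_assoc, h₃]
    simp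
  · rw [whisker_exchange_assoc, h₄]
    simp

variable (I) in
/-- The interval itself, as a 2-cell `⊥ ⇒ ⊤` between maps `U ⟶ I`. -/
noncomputable def walk : (⟨I.bot⟩ : I.HomCat (𝟙_ E) I.C₁) ⟶ ⟨I.top⟩ :=
  Homotopy.mk (λ_ I.C₁).hom
    ⟨by rw [leftUnitor_naturality, unitors_equal], by rw [leftUnitor_naturality, unitors_equal]⟩

/-- The meet fills the square whose sides are the walk `⊥ ⇒ ⊤` twice and the identity of `⊥`
twice. -/
theorem exists_meet (hI : I.IsRepresentable) :
    ∃ m : I.C₁ ⊗ I.C₁ ⟶ I.C₁, IsBoundedOp I.bot I.top m := by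
  let s : Arrow.mk (𝟙 (⟨I.bot⟩ : I.HomCat (𝟙_ E) I.C₁)) ⟶ Arrow.mk I.walk :=
    Arrow.homMk (𝟙 _) I.walk (by simp)
  obtain ⟨m, h₁, h₂, h₃, h₄⟩ := exists_square hI s
  have hid : Homotopy.map (𝟙 (⟨I.bot⟩ : I.HomCat (𝟙_ E) I.C₁)) =
      (λ_ I.C₁).hom ≫ I.i ≫ I.bot := by
    rw [id_map, ← unitors_equal, leftUnitor_naturality_assoc]
  refine ⟨m, h₁.trans hid, ?_, h₂, ?_⟩
  · rw [h₃]
    change _ ≫ _ ≫ Homotopy.map (𝟙 (⟨I.bot⟩ : I.HomCat (𝟙_ E) I.C₁)) = _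
    rw [hid, Iso.inv_hom_id_assoc]
    rfl
  · rw [h₄]
    change _ ≫ _ ≫ (λ_ I.C₁).hom = _
    simp

/-- The join fills the square whose sides are the walk `⊥ ⇒ ⊤` twice and the identity of `⊤`
twice. -/
theorem exists_join (hI : I.IsRepresentable) :
    ∃ j : I.C₁ ⊗ I.C₁ ⟶ I.C₁, IsBoundedOp I.top I.bot j := by
  let s : Arrow.mk I.walk ⟶ Arrow.mk (𝟙 (⟨I.top⟩ : I.HomCat (𝟙_ E) I.C₁)) :=
    Arrow.homMk I.walk (𝟙 _) (by simp)
  obtain ⟨j, h₁, h₂, h₃, h₄⟩ := exists_square hI s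
  have hid : Homotopy.map (𝟙 (⟨I.top⟩ : I.HomCat (𝟙_ E) I.C₁)) =
      (λ_ I.C₁).hom ≫ I.i ≫ I.top := by
    rw [id_map, ← unitors_equal, leftUnitor_naturality_assoc]
  refine ⟨j, h₂.trans hid, ?_, h₁, ?_⟩
  · rw [h₄]
    change _ ≫ _ ≫ Homotopy.map (𝟙 (⟨I.top⟩ : I.HomCat (𝟙_ E) I.C₁)) = _
    rw [hid, Iso.inv_hom_id_assoc]
    rfl
  · rw [h₃]
    change _ ≫ _ ≫ (λ_ I.C₁).hom = _
    simp

end Representable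

section Symmetric

variable {E : Type u} [Category.{v} E] [MonoidalCategory E] [SymmetricCategory E]
  [HasPushouts E] {I : Interval E}

/-- The four faces that make a map a bounded operation are the sources and targets of the map and of
its composite with the symmetry, viewed as 2-cells. -/
theorem isHomotopy_meet_iff {m : I.C₁ ⊗ I.C₁ ⟶ I.C₁} :
    (I.IsHomotopy m (I.i ≫ I.bot) (𝟙 I.C₁) ∧
      I.IsHomotopy ((β_ I.C₁ I.C₁).hom ≫ m) (I.i ≫ I.bot) (𝟙 I.C₁)) ↔
        IsBoundedOp I.bot I.top m := by
  constructor
  · rintro ⟨⟨h₁, h₂⟩, ⟨h₃, h₄⟩⟩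
    rw [BraidedCategory.braiding_naturality_right_assoc] at h₃ h₄
    refine ⟨?_, h₁, ?_, h₂.trans (Category.comp_id _)⟩
    · rw [← cancel_epi (β_ I.C₁ (𝟙_ E)).hom, h₃]
      simp
      rfl
    · rw [← cancel_epi (β_ I.C₁ (𝟙_ E)).hom, h₄]
      simp
  · intro h
    exact ⟨⟨h.zero_right, h.unit_right.trans (Category.comp_id _).symm⟩,
      h.braiding.zero_right, h.braiding.unit_right.trans (Category.comp_id _).symm⟩

theorem isHomotopy_join_iff {j : I.C₁ ⊗ I.C₁ ⟶ I.C₁} :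
    (I.IsHomotopy j (𝟙 I.C₁) (I.i ≫ I.top) ∧
      I.IsHomotopy ((β_ I.C₁ I.C₁).hom ≫ j) (𝟙 I.C₁) (I.i ≫ I.top)) ↔
        IsBoundedOp I.top I.bot j := by
  constructor
  · rintro ⟨⟨h₁, h₂⟩, ⟨h₃, h₄⟩⟩
    rw [BraidedCategory.braiding_naturality_right_assoc] at h₃ h₄
    refine ⟨?_, h₂, ?_, h₁.trans (Category.comp_id _)⟩
    · rw [← cancel_epi (β_ I.C₁ (𝟙_ E)).hom, h₄]
      simp
      rfl
    · rw [← cancel_epi (β_ I.C₁ (𝟙_ E)).hom, h₃]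
      simp
  · intro h
    exact ⟨⟨h.unit_right.trans (Category.comp_id _).symm, h.zero_right⟩,
      h.braiding.unit_right.trans (Category.comp_id _).symm, h.braiding.zero_right⟩

variable [MonoidalClosed E]

/-- For a representable interval, a map out of `I ⊗ (I ⊗ C)` is determined by its faces in the two
factors `I`. -/
theorem facesJointlyEpic (hI : I.IsRepresentable) : FacesJointlyEpic I.bot I.top := by
  intro C A f g h₁ h₂ h₃ h₄
  obtain ⟨c⟩ := hI A
  -- The symmetry moves the spectator `C` to the front, where the cotensor expects it.
  let s (X Y : E) : (C ⊗ X) ⊗ Y ⟶ X ⊗ (Y ⊗ C) :=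
    (α_ C X Y).hom ≫ (β_ C (X ⊗ Y)).hom ≫ (α_ X Y C).hom
  have hs₁ (p : 𝟙_ E ⟶ I.C₁) :
      (C ◁ p) ▷ I.C₁ ≫ s I.C₁ I.C₁ = s _ _ ≫ p ▷ (I.C₁ ⊗ C) := by
    simp only [s, Category.assoc]
    rw [associator_naturality_middle_assoc, BraidedCategory.braiding_naturality_right_assoc,
      associator_naturality_left]
  have hs₂ (p : 𝟙_ E ⟶ I.C₁) :
      (C ⊗ I.C₁) ◁ p ≫ s I.C₁ I.C₁ = s _ _ ≫ I.C₁ ◁ p ▷ C := by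
    simp only [s, Category.assoc]
    rw [associator_naturality_right_assoc, BraidedCategory.braiding_naturality_right_assoc,
      associator_naturality_middle]
  have hepi : Epi (s I.C₁ I.C₁) := by
    dsimp only [s]
    infer_instance
  rw [← cancel_epi (s I.C₁ I.C₁)]
  apply c.hom_ext
  · rw [reassoc_of% hs₁, reassoc_of% hs₁, h₁]
  · rw [reassoc_of% hs₁, reassoc_of% hs₁, h₂]
  · rw [reassoc_of% hs₂, reassoc_of% hs₂, h₃]
  · rw [reassoc_of% hs₂, reassoc_of% hs₂, h₄]

end Symmetric

end Interval

end RepInterval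

theorem mainTheorem2 {E : Type u} [Category.{v} E] [MonoidalCategory E] [SymmetricCategory E]
    [MonoidalClosed E] [HasFiniteLimits E] [HasFiniteColimits E]
    (I : RepInterval.Interval E) (hI : I.IsRepresentable) :
    ∃ meet join : I.C₁ ⊗ I.C₁ ⟶ I.C₁,
      RepInterval.IsUnitalDistribLattice I.bot I.top meet join ∧
      -- the structure is unique
      (∀ meet' join' : I.C₁ ⊗ I.C₁ ⟶ I.C₁,
        RepInterval.IsUnitalDistribLattice I.bot I.top meet' join' →
          meet' = meet ∧ join' = join) ∧
      -- meet is the only map such that it and its composite with the symmetry are 2-cells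
      (∀ m : I.C₁ ⊗ I.C₁ ⟶ I.C₁,
        (I.IsHomotopy m (I.i ≫ I.bot) (𝟙 I.C₁) ∧
          I.IsHomotopy ((β_ I.C₁ I.C₁).hom ≫ m) (I.i ≫ I.bot) (𝟙 I.C₁)) ↔ m = meet) ∧
      -- join is the only map such that it and its composite with the symmetry are 2-cells
      (∀ j : I.C₁ ⊗ I.C₁ ⟶ I.C₁,
        (I.IsHomotopy j (𝟙 I.C₁) (I.i ≫ I.top) ∧
          I.IsHomotopy ((β_ I.C₁ I.C₁).hom ≫ j) (𝟙 I.C₁) (I.i ≫ I.top)) ↔ j = join) := by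
  have hfaces := RepInterval.Interval.facesJointlyEpic hI
  obtain ⟨meet, hm⟩ := RepInterval.Interval.exists_meet hI
  obtain ⟨join, hj⟩ := RepInterval.Interval.exists_join hI
  refine ⟨meet, join, hm.isUnitalDistribLattice hfaces I.isGrouplike_bot I.isGrouplike_top hj
    (RepInterval.Interval.diag_meet hm) (RepInterval.Interval.diag_join hj), ?_, ?_, ?_⟩
  · intro meet' join' h
    exact ⟨h.isBoundedOp_meet.unique hfaces hm, h.isBoundedOp_join.unique hfaces.symm hj⟩
  · intro m
    rw [RepInterval.Interval.isHomotopy_meet_iff]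
    exact ⟨fun h => h.unique hfaces hm, fun h => h ▸ hm⟩
  · intro j
    rw [RepInterval.Interval.isHomotopy_join_iff]
    exact ⟨fun h => h.unique hfaces.symm hj, fun h => h ▸ hj⟩
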